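/- For a group $G$ let $\mathcal V(\mathbb ZG)$ denote the group of normalized units of the integral group ring $\mathbb ZG$, i.e. the units of augmentation one; $G$ is regarded as a subgroup of $\mathcal V(\mathbb ZG)$ in the canonical way, and $X'$ denotes the derived (commutator) subgroup of a group $X$. A Hamiltonian $2$-group is a non-abelian $2$-group all of whose subgroups are normal. Let $G$ be a finite group. Then $\mathcal V(\mathbb ZG)' = G'$ if and only if $G$ is abelian or a Hamiltonian $2$-group. Moreover, $G$ is a Hamiltonian $2$-group if and only if $G\cong Q_8\times E$, where $Q_8$ is the quaternion group of order $8$ and $E$ is a (possibly trivial) group satisfying $e^2=1$ for all $e\in E$. -/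

import Mathlib

universe u

/-- The augmentation map `ℤG → ℤ`, `∑ a_g g ↦ ∑ a_g`. -/
noncomputable def augmentation (G : Type*) [Group G] : MonoidAlgebra ℤ G →ₐ[ℤ] ℤ :=
  MonoidAlgebra.lift ℤ ℤ G (1 : G →* ℤ)

/-- The group `V(ℤG)` of normalized units of `ℤG`, that is, the units of augmentation one. -/
def normalizedUnits (G : Type*) [Group G] : Subgroup (MonoidAlgebra ℤ G)ˣ where
  carrier := {u | augmentation G (u : MonoidAlgebra ℤ G) = 1}
  one_mem' := by simp
  mul_mem' := by
    intro u v hu hv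
    simp only [Set.mem_ofPred_eq] at hu hv ⊢
    rw [Units.val_mul, map_mul, hu, hv, one_mul]
  inv_mem' := by
    intro u hu
    simp only [Set.mem_ofPred_eq] at hu ⊢
    have h : augmentation G ((u : MonoidAlgebra ℤ G) * ((u⁻¹ : (MonoidAlgebra ℤ G)ˣ) :
        MonoidAlgebra ℤ G)) = 1 := by rw [Units.mul_inv, map_one]
    rwa [map_mul, hu, one_mul] at h

/-- The canonical embedding of `G` into `V(ℤG)`, sending `g` to the group ring element `g`. -/
noncomputable def groupToNormalizedUnits (G : Type*) [Group G] : G →* normalizedUnits G :=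
  (MonoidAlgebra.of ℤ G).toHomUnits.codRestrict (normalizedUnits G) (by
    intro g
    change augmentation G (MonoidAlgebra.of ℤ G g) = 1
    rw [augmentation, MonoidAlgebra.lift_of, MonoidHom.one_apply])

/-- A Hamiltonian group: a non-abelian group all of whose subgroups are normal. -/
def IsHamiltonianGroup (G : Type*) [Group G] : Prop :=
  (∃ a b : G, a * b ≠ b * a) ∧ ∀ H : Subgroup G, H.Normal

/-- A Hamiltonian `2`-group. -/
def IsHamiltonianTwoGroup (G : Type*) [Group G] : Prop :=
  IsHamiltonianGroup G ∧ IsPGroup 2 G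

/-! If `V(ℤG)' = G'`, then for a normalized unit `v` and `g ∈ G` the commutator `[v, g]` lies in
`G`, so `v` normalizes `G` (`UnitsNormalize`). Two families of units turn this into strong
restrictions on a finite `G`.

Bicyclic units `1 + 3(1 - h)g(1 + h + ⋯)` force `h` to generate a normal subgroup, so every subgroup
is normal (`UnitsNormalize.normal`). Bass cyclic units in `ℤ⟨c⟩`, evaluated at roots of unity, then
show that conjugation sends each `c` to `c` or `c⁻¹` (`UnitsNormalize.conj_eq_or_eq_inv`). In a
non-abelian group this excludes elements of odd prime order, so `G` is a Hamiltonian 2-group.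

The structure theorem is the Dedekind–Baer argument: two non-commuting elements of minimal order
generate a copy of `Q₈`, its centralizer has exponent 2, and a complement `E` of `⟨a²⟩` in the
centralizer gives `G ≅ Q₈ × E`.

For such `G` all units are `±g` (Higman). The property is phrased as "the squares of the
coefficients sum to 1". This holds for `Q₈` by a Parseval identity over its four linear characters
and its quaternion representation, and it passes from `A` to `A × C₂` by the parallelogram law. Then
`V(ℤG) = G` and the derived subgroups agree. For abelian `G` both are trivial. -/

/-! ### Bass cyclic units and evaluation at roots of unity -/

section Bass

open Polynomial Finset

/-- Bass cyclic units, at the level of polynomials modulo `X ^ n - 1`. -/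
theorem exists_bass_polynomial {n k m : ℕ} (hn : 1 < n) (hk : k.Coprime n)
    (hm : ∀ i : ℕ, i.Coprime n → (n : ℤ) ∣ 1 - (i : ℤ) ^ m) :
    ∃ P Q : ℤ[X], P.eval 1 = 1 ∧ X ^ n - 1 ∣ P * Q - 1 ∧
      ∀ ζ : ℂ, ζ ^ n = 1 → ζ ≠ 1 → aeval ζ P * (ζ - 1) ^ m = (ζ ^ k - 1) ^ m := by
  obtain ⟨l, -, hl⟩ := Nat.exists_mul_mod_eq_one_of_coprime hk hn
  have hln : l.Coprime n := by
    have h1 : (k * l).Coprime n := by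
      have : (k * l) % n = 1 % n := by rw [hl, Nat.mod_eq_of_lt hn]
      exact (Nat.ModEq.gcd_eq this).trans (by simp)
    exact Nat.Coprime.coprime_mul_left h1
  obtain ⟨a, ha⟩ := hm k hk
  obtain ⟨b, hb⟩ := hm l hln
  set t := k * l / n with ht
  have hkl : k * l = n * t + 1 := by rw [← Nat.div_add_mod (k * l) n, hl]
  set N : ℤ[X] := ∑ i ∈ range n, X ^ i with hN
  have hNX : N * (X - 1) = X ^ n - 1 := geom_sum_mul _ _
  have hX : (X - 1 : ℤ[X]) ≠ 0 := X_sub_C_ne_zero 1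
  have hdvd : N ∣ (∑ i ∈ range k, X ^ i) * (∑ i ∈ range l, (X ^ k) ^ i) - 1 := by
    have h1 : (X ^ n - 1 : ℤ[X]) ∣ (X ^ n) ^ t - 1 := sub_one_dvd_pow_sub_one _ _
    rw [← mul_dvd_mul_iff_right hX, hNX, sub_mul, mul_assoc,
      mul_comm (∑ i ∈ range l, _), ← mul_assoc, geom_sum_mul, mul_comm (X ^ k - 1), geom_sum_mul,
      ← pow_mul, hkl, pow_succ, pow_mul]
    obtain ⟨w, hw⟩ := h1
    exact ⟨X * w, by linear_combination X * hw⟩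
  have heN : N.eval 1 = (n : ℤ) := by simp [hN, eval_finsetSum]
  -- As `1 - k ^ m = n * a` and `N(1) = n`, the correction `a * N` makes the value at `1` equal to
  -- `1`. It vanishes at every other `n`-th root of unity.
  set P : ℤ[X] := (∑ i ∈ range k, X ^ i) ^ m + C a * N with hP
  set Q : ℤ[X] := (∑ i ∈ range l, (X ^ k) ^ i) ^ m + C b * N with hQ
  have hP1 : P.eval 1 = 1 := by
    simp [hP, eval_finsetSum, heN]; linarith
  have hQ1 : Q.eval 1 = 1 := by
    simp [hQ, eval_finsetSum, heN]; linarith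
  refine ⟨P, Q, hP1, ?_, ?_⟩
  · have h2 : N ∣ P * Q - 1 := by
      have h3 : N ∣ ((∑ i ∈ range k, X ^ i) * (∑ i ∈ range l, (X ^ k) ^ i)) ^ m - 1 :=
        hdvd.trans (sub_one_dvd_pow_sub_one _ _)
      obtain ⟨w, hw⟩ := h3
      refine ⟨w + C a * (∑ i ∈ range l, (X ^ k) ^ i) ^ m + C b * (∑ i ∈ range k, X ^ i) ^ m
        + C a * C b * N, ?_⟩
      rw [hP, hQ]
      rw [mul_pow] at hw
      linear_combination hw
    obtain ⟨F, hF⟩ := h2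
    -- Divisibility by `N` is upgraded to `X ^ n - 1 = N * (X - 1)`: the cofactor `F` must vanish at
    -- `1`.
    have h4 : (n : ℤ) * F.eval 1 = 0 := by
      rw [← heN, ← eval_mul, ← hF]; simp [hP1, hQ1]
    have h5 : F.IsRoot 1 := by
      rcases mul_eq_zero.1 h4 with h | h
      · omega
      · exact h
    obtain ⟨E, hE⟩ := dvd_iff_isRoot.2 h5
    refine ⟨E, ?_⟩
    rw [hF, hE, ← hNX]; simp; ring
  · intro ζ hζ hζ1
    have h6 : aeval ζ N = 0 := by
      have := congrArg (aeval ζ) hNX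
      simp only [map_mul, map_sub, map_pow, aeval_X, map_one, hζ, sub_self] at this
      exact (mul_eq_zero.1 this).resolve_right (sub_ne_zero.2 hζ1)
    rw [hP, map_add, map_mul, h6, mul_zero, add_zero, map_pow, ← mul_pow]
    simp [geom_sum_mul]

/-- A polynomial relation satisfied by `g` in `ℤG` is satisfied by roots of unity. -/
theorem aeval_eq_of_aeval_of_eq {G : Type*} [Group G] (c : G) {ζ : ℂ} (hζ : ζ ^ orderOf c = 1)
    {P Q : ℤ[X]} (h : aeval (MonoidAlgebra.of ℤ G c) P = aeval (MonoidAlgebra.of ℤ G c) Q) :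
    aeval ζ P = aeval ζ Q := by
  classical
  -- Only an additive functional on `ℤG` is needed: `c ^ i ↦ ζ ^ i`, and zero off the powers of `c`.
  -- The choice of exponent is harmless because the order of `ζ` divides that of `c`.
  let f : G → ℂ := fun g => if hg : ∃ i : ℕ, c ^ i = g then ζ ^ hg.choose else 0
  have hf : ∀ i : ℕ, f (c ^ i) = ζ ^ i := by
    intro i
    have hg : ∃ i' : ℕ, c ^ i' = c ^ i := ⟨i, rfl⟩
    simp only [f, dif_pos hg]
    have h1 : hg.choose ≡ i [MOD orderOf ζ] :=
      (pow_eq_pow_iff_modEq.1 hg.choose_spec).of_dvd (orderOf_dvd_of_pow_eq_one hζ)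
    rw [← pow_mod_orderOf, h1, pow_mod_orderOf]
  obtain ⟨L, hLs⟩ : ∃ L : (G →₀ ℤ) →+ ℂ, ∀ g r, L (Finsupp.single g r) = r • f g :=
    ⟨Finsupp.liftAddHom fun g => zmultiplesHom ℂ (f g), fun g r => by
      rw [Finsupp.liftAddHom_apply_single, zmultiplesHom_apply]⟩
  have hL : ∀ R : ℤ[X], L (aeval (MonoidAlgebra.of ℤ G c) R).coeff = aeval ζ R := by
    intro R
    induction R using Polynomial.induction_on' with
    | add p q hp hq => simp only [map_add, MonoidAlgebra.coeff_add, hp, hq]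
    | monomial i r =>
      rw [aeval_monomial, aeval_monomial, ← map_pow, ← Algebra.smul_def, MonoidAlgebra.smul_of,
        MonoidAlgebra.coeff_single, hLs, hf, zsmul_eq_mul, eq_intCast]
  rw [← hL, ← hL, h]

theorem aeval_of_one_augmentation {G : Type*} [Group G] (c : G) (P : ℤ[X]) :
    augmentation G (aeval (MonoidAlgebra.of ℤ G c) P) = P.eval 1 := by
  rw [← Polynomial.aeval_algHom_apply, augmentation, MonoidAlgebra.lift_of]
  simp [aeval_def]

end Bass

/-- Every normalized unit conjugates elements of `G` into `G`. -/
def UnitsNormalize (G : Type*) [Group G] : Prop :=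
  ∀ u w : MonoidAlgebra ℤ G, u * w = 1 → w * u = 1 → augmentation G u = 1 →
    ∀ g : G, ∃ h : G, u * MonoidAlgebra.of ℤ G g = MonoidAlgebra.of ℤ G h * u

open scoped commutatorElement in
theorem unitsNormalize_of_commutator_eq {G : Type*} [Group G]
    (h : commutator (normalizedUnits G) = (commutator G).map (groupToNormalizedUnits G)) :
    UnitsNormalize G := by
  intro u w huw hwu hu g
  let v : normalizedUnits G := ⟨⟨u, w, huw, hwu⟩, hu⟩
  have h1 : ⁅v, groupToNormalizedUnits G g⁆ ∈ commutator (normalizedUnits G) :=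
    Subgroup.commutator_mem_commutator (Subgroup.mem_top _) (Subgroup.mem_top _)
  rw [h] at h1
  obtain ⟨k, -, hk⟩ := h1
  have h2 : v * groupToNormalizedUnits G g = groupToNormalizedUnits G (k * g) * v := by
    rw [map_mul, hk, commutatorElement_def]; group
  refine ⟨k * g, ?_⟩
  exact congrArg (fun x : normalizedUnits G => ((x : (MonoidAlgebra ℤ G)ˣ) : MonoidAlgebra ℤ G)) h2

/-! ### Bicyclic units force every subgroup to be normal -/

section Normal

open MonoidAlgebra Finset

theorem bicyclic_mul_self {A : Type*} [Ring A] {c s : A} (hs : s * c = s) (d : A) :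
    ((1 - c) * d * s) * ((1 - c) * d * s) = 0 := by
  have h1 : s * (1 - c) = 0 := by rw [mul_sub, mul_one, hs, sub_self]
  have h2 : ((1 - c) * d * s) * ((1 - c) * d * s) = (1 - c) * d * (s * (1 - c)) * (d * s) := by
    simp only [mul_assoc]
  rw [h2, h1, mul_zero, zero_mul]

theorem one_add_mul_one_sub_of_mul_self {A : Type*} [Ring A] {x : A} (hx : x * x = 0) :
    (1 + x) * (1 - x) = 1 := by
  rw [mul_sub, mul_one, add_mul, one_mul, hx, add_zero, add_sub_cancel_right]

theorem one_sub_mul_one_add_of_mul_self {A : Type*} [Ring A] {x : A} (hx : x * x = 0) :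
    (1 - x) * (1 + x) = 1 := by
  rw [mul_add, mul_one, sub_mul, one_mul, hx, sub_zero, sub_add_cancel]

theorem eq_of_one_add_mul_eq {A : Type*} [Ring A] {x c k : A} (hx : x * x = 0) (hxc : x * c = x)
    (h : (1 + x) * c = k * (1 + x)) : k = c + (1 - c) * x := by
  have h1 : k = (1 + x) * c * (1 - x) := by
    rw [h, mul_assoc, one_add_mul_one_sub_of_mul_self hx, mul_one]
  rw [h1, add_mul, one_mul, hxc, mul_sub, mul_one, add_mul, hx, add_zero, sub_mul, one_mul]
  abel

/-- `1 - c` is semisimple when `c` has finite order. -/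
theorem one_sub_mul_eq_zero_of_sq {A : Type*} [Ring A] [IsAddTorsionFree A] {c : A} {n : ℕ}
    (hn : n ≠ 0) (hc : c ^ n = 1) {y : A} (h : (1 - c) * ((1 - c) * y) = 0) : (1 - c) * y = 0 := by
  set a := (1 - c) * y with ha
  have hca : c * a = a := by rw [sub_mul, one_mul, sub_eq_zero] at h; exact h.symm
  have hcy : c * y = y - a := by rw [ha, sub_mul, one_mul, sub_sub_cancel]
  -- Since `c` fixes `a`, each multiplication by `c` subtracts another `a`; at `i = n` this reads `n
  -- • a = 0`.
  have hy : ∀ i : ℕ, c ^ i * y = y - i • a := by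
    intro i
    induction i with
    | zero => simp
    | succ i ih => rw [pow_succ', mul_assoc, ih, mul_sub, hcy, mul_smul_comm, hca, succ_nsmul]; abel
  have h8 := hy n
  rw [hc, one_mul, eq_comm, sub_eq_self] at h8
  exact (smul_eq_zero.1 h8).resolve_left hn

instance {G : Type*} : IsAddTorsionFree (MonoidAlgebra ℤ G) :=
  Function.Injective.isAddTorsionFree (coeffAddEquiv (R := ℤ) (M := G)).toAddMonoidHom
    coeffAddEquiv.injective

/-- Conjugating `h` by the bicyclic unit `1 + x` gives `h + (1 - h)x`, which must be a group
element. This forces `(1 - h)x = 0`, and semisimplicity of `1 - h` then gives `h g s = g s`, where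
`s` is the sum of the powers of `h`. -/
theorem UnitsNormalize.normal {G : Type*} [Group G] [Finite G] (H : UnitsNormalize G)
    (K : Subgroup G) : K.Normal := by
  classical
  suffices key : ∀ h g : G, g⁻¹ * h * g ∈ Subgroup.zpowers h by
    refine ⟨fun h hh g => ?_⟩
    have := key h g⁻¹
    rw [inv_inv] at this
    exact (Subgroup.zpowers_le.2 hh) this
  intro h g
  obtain ⟨c, hc⟩ : ∃ c, c = of ℤ G h := ⟨_, rfl⟩
  obtain ⟨d, hd⟩ : ∃ d, d = of ℤ G g := ⟨_, rfl⟩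
  obtain ⟨s, hs⟩ : ∃ s, s = ∑ i ∈ range (orderOf h), c ^ i := ⟨_, rfl⟩
  have hcn : c ^ orderOf h = 1 := by rw [hc, ← map_pow, pow_orderOf_eq_one, map_one]
  have hsc : s * c = s := by
    have : s * (c - 1) = 0 := by rw [hs, geom_sum_mul, hcn, sub_self]
    rwa [mul_sub, mul_one, sub_eq_zero] at this
  -- The factor 3 makes the unit congruent to `1` modulo 3, so that comparing coefficients modulo 3
  -- yields `k = h`; any factor above 1 would serve.
  obtain ⟨x, hx⟩ : ∃ x, x = (1 - c) * ((3 : ℕ) • d) * s := ⟨_, rfl⟩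
  have hxx : x * x = 0 := by rw [hx, bicyclic_mul_self hsc]
  have hxc : x * c = x := by rw [hx, mul_assoc, hsc]
  have haug : augmentation G x = 0 := by
    have h1 : augmentation G c = 1 := by rw [hc, augmentation, lift_of, MonoidHom.one_apply]
    rw [hx, map_mul, map_mul, map_sub, h1, map_one, sub_self, zero_mul, zero_mul]
  obtain ⟨k, hk⟩ := H _ _ (one_add_mul_one_sub_of_mul_self hxx)
    (one_sub_mul_one_add_of_mul_self hxx) (by rw [map_add, map_one, haug, add_zero]) h
  rw [← hc] at hk
  have hk' := eq_of_one_add_mul_eq hxx hxc hk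
  have hx3 : (1 - c) * x = (3 : ℕ) • ((1 - c) * ((1 - c) * (d * s))) := by
    rw [hx]; simp only [mul_smul_comm, smul_mul_assoc, mul_assoc]
  rw [hx3] at hk'
  have hkh : k = h := by
    by_contra hne
    have h3 := congrArg (fun x => coeff x k) hk'
    rw [hc, of_apply, of_apply, coeff_add, Finsupp.add_apply, coeff_smul_apply, coeff_single,
      coeff_single, Finsupp.single_apply, Finsupp.single_apply, if_pos rfl,
      if_neg (Ne.symm hne), zero_add, nsmul_eq_mul] at h3
    push_cast at h3
    omega
  rw [hkh, ← hc] at hk'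
  have h4 := (smul_eq_zero.1 (left_eq_add.1 hk')).resolve_left (by norm_num)
  have hfin := one_sub_mul_eq_zero_of_sq (orderOf_pos h).ne' hcn h4
  rw [sub_mul, one_mul, sub_eq_zero, ← mul_assoc] at hfin
  have hcoeff : ∀ x, s.coeff x = ∑ i ∈ range (orderOf h), if h ^ i = x then 1 else 0 := by
    intro x
    rw [hs, hc, coeff_sum, Finsupp.finsetSum_apply]
    refine sum_congr rfl fun i _ => ?_
    rw [← map_pow, of_apply, coeff_single, Finsupp.single_apply]
  -- At `h * g` the equation equates the coefficient of `s` at `1`, which is positive, with its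
  -- coefficient at `g⁻¹ * h * g`.
  have h9 := congrArg (fun x => coeff x (h * g)) hfin
  rw [hc, hd, ← map_mul, of_apply, of_apply, coeff_single_mul_apply, coeff_single_mul_apply,
    one_mul, one_mul, inv_mul_cancel, ← mul_assoc, hcoeff, hcoeff] at h9
  have h10 : 0 < ∑ i ∈ range (orderOf h), if h ^ i = 1 then (1 : ℤ) else 0 := by
    refine sum_pos' (fun i _ => by split <;> simp) ⟨0, mem_range.2 (orderOf_pos h), by simp⟩
  rw [← h9] at h10
  obtain ⟨i, -, hi⟩ := exists_ne_zero_of_sum_ne_zero h10.ne'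
  have : h ^ i = g⁻¹ * h * g := by by_contra hne; simp [hne] at hi
  rw [← this]
  exact Subgroup.npow_mem_zpowers h i

end Normal

/-! ### Conjugation fixes or inverts each element -/

section Conj

open Polynomial

/-- Conjugating the unit `P(c)` by `y` gives `P(c ^ j)`, which equals a group element times `P(c)`.
That element lies in the commutative ring `ℤ⟨c⟩`, so raising to the power `|G|` removes it; `c` is
then specialized to `ζ`. -/
theorem UnitsNormalize.aeval_pow_card_eq {G : Type*} [Group G] (H : UnitsNormalize G)
    {c y : G} {j : ℕ} (hy : y * c * y⁻¹ = c ^ j) {P Q : ℤ[X]} (hP : P.eval 1 = 1)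
    (hPQ : X ^ orderOf c - 1 ∣ P * Q - 1) {ζ : ℂ} (hζ : ζ ^ orderOf c = 1) :
    aeval (ζ ^ j) P ^ Nat.card G = aeval ζ P ^ Nat.card G := by
  obtain ⟨e, he⟩ : ∃ e, e = MonoidAlgebra.of ℤ G c := ⟨_, rfl⟩
  have hen : e ^ orderOf c = 1 := by rw [he, ← map_pow, pow_orderOf_eq_one, map_one]
  have hPQe : aeval e P * aeval e Q = 1 := by
    obtain ⟨F, hF⟩ := hPQ
    have := congrArg (aeval e) hF
    simpa [hen, sub_eq_zero] using this
  have hQPe : aeval e Q * aeval e P = 1 := by rw [← map_mul, mul_comm, map_mul, hPQe]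
  obtain ⟨k, hk⟩ := H _ _ hPQe hQPe (by rw [he, aeval_of_one_augmentation, hP]) y⁻¹
  have hconj : MonoidAlgebra.of ℤ G y * aeval e P = aeval e (P.comp (X ^ j)) *
      MonoidAlgebra.of ℤ G y := by
    have h1 : ∀ R : ℤ[X], MonoidAlgebra.of ℤ G y * aeval e R =
        aeval (e ^ j) R * MonoidAlgebra.of ℤ G y := by
      intro R
      have h2 : MonoidAlgebra.of ℤ G y * e = e ^ j * MonoidAlgebra.of ℤ G y := by
        rw [he, ← map_mul, ← map_pow, ← map_mul, ← hy, inv_mul_cancel_right]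
      have h3 : ∀ i : ℕ, MonoidAlgebra.of ℤ G y * e ^ i =
          (e ^ j) ^ i * MonoidAlgebra.of ℤ G y := fun i => (SemiconjBy.pow_right h2 i)
      induction R using Polynomial.induction_on' with
      | add p q hp hq => rw [map_add, map_add, mul_add, add_mul, hp, hq]
      | monomial i r =>
        rw [aeval_monomial, aeval_monomial, ← Algebra.smul_def, ← Algebra.smul_def,
          mul_smul_comm, h3, smul_mul_assoc]
    rw [h1, aeval_comp, map_pow, aeval_X]
  have hyy : MonoidAlgebra.of ℤ G y * MonoidAlgebra.of ℤ G y⁻¹ = 1 := by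
    rw [← map_mul, mul_inv_cancel, map_one]
  have hU : aeval e (P.comp (X ^ j)) = MonoidAlgebra.of ℤ G (y * k) * aeval e P := by
    rw [map_mul, mul_assoc, ← hk, ← mul_assoc, hconj, mul_assoc, hyy, mul_one]
  have hg : MonoidAlgebra.of ℤ G (y * k) = aeval e (P.comp (X ^ j) * Q) := by
    rw [map_mul (aeval e), hU, mul_assoc, hPQe, mul_one]
  have hcomm : Commute (MonoidAlgebra.of ℤ G (y * k)) (aeval e P) := by
    rw [hg]; exact Commute.map (Commute.all _ _) (aeval e)
  have hpow : aeval e ((P.comp (X ^ j)) ^ Nat.card G) = aeval e (P ^ Nat.card G) := by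
    rw [map_pow, hU, hcomm.mul_pow, ← map_pow, pow_card_eq_one', map_one, one_mul, map_pow]
  rw [he] at hpow
  have := aeval_eq_of_aeval_of_eq c hζ hpow
  rwa [map_pow, map_pow, aeval_comp, map_pow, aeval_X] at this

theorem eq_or_eq_inv_of_norm_sub_one_eq {z w : ℂ} (hz : ‖z‖ = 1) (hw : ‖w‖ = 1)
    (h : ‖z - 1‖ = ‖w - 1‖) : z = w ∨ z = w⁻¹ := by
  have hw' : w⁻¹ = (starRingEnd ℂ) w := by
    rw [Complex.inv_def, Complex.normSq_eq_norm_sq, hw]; simp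
  have h1 : ∀ u : ℂ, ‖u‖ ^ 2 = u.re ^ 2 + u.im ^ 2 := fun u => by
    rw [← Complex.normSq_eq_norm_sq, Complex.normSq_apply]; ring
  have hz2 := h1 z
  have hw2 := h1 w
  have hz3 := h1 (z - 1)
  have hw3 := h1 (w - 1)
  rw [h] at hz3
  simp only [Complex.sub_re, Complex.sub_im, Complex.one_re, Complex.one_im, hz, hw] at *
  have hre : z.re = w.re := by nlinarith
  have him : (z.im - w.im) * (z.im + w.im) = 0 := by
    rw [hre] at hz2; nlinarith
  rw [hw']
  rcases mul_eq_zero.1 him with h2 | h2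
  · left; exact Complex.ext hre (by linarith)
  · right; refine Complex.ext (by simpa using hre) (by simp; linarith)

/-- With `c ↦ c ^ j` and the Bass polynomial for `k = j`, the numbers `‖P(ζ ^ j ^ i)‖` do not depend
on `i`. Hence `‖ζ ^ j ^ i - 1‖` is a geometric progression in `i`. It is also periodic, so its ratio
is 1 and `ζ ^ j` is `ζ` or `ζ⁻¹`. -/
theorem UnitsNormalize.conj_eq_or_eq_inv {G : Type*} [Group G] [Finite G]
    (H : UnitsNormalize G) (c y : G) : y * c * y⁻¹ = c ∨ y * c * y⁻¹ = c⁻¹ := by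
  classical
  have hmem : y * c * y⁻¹ ∈ Subgroup.zpowers c :=
    (H.normal (Subgroup.zpowers c)).conj_mem _ (Subgroup.mem_zpowers c) y
  obtain ⟨j, hj⟩ := mem_zpowers_iff_mem_range_orderOf.1 hmem |> Finset.mem_image.1
  replace hj := hj.2
  obtain ⟨n, hn⟩ : ∃ n, n = orderOf c := ⟨_, rfl⟩
  rcases Nat.lt_or_ge 1 n with hn1 | hn1
  swap
  · have : n = 1 := le_antisymm hn1 (hn ▸ orderOf_pos c)
    have hc : c = 1 := orderOf_eq_one_iff.1 (hn ▸ this)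
    left; simp [hc]
  have hjn : j.Coprime n := by
    have h1 : orderOf (c ^ j) = orderOf c := by
      rw [hj]; exact orderOf_injective (MulAut.conj y).toMonoidHom (MulAut.conj y).injective c
    rw [orderOf_pow, ← hn] at h1
    rw [Nat.coprime_comm]
    have h2 : n.gcd j * n = n := by
      have h3 := Nat.mul_div_cancel' (Nat.gcd_dvd_left n j)
      rwa [h1] at h3
    exact Nat.eq_of_mul_eq_mul_right (by omega) (h2.trans (one_mul n).symm)
  have hφ : 0 < Nat.totient n := Nat.totient_pos.2 (by omega)
  obtain ⟨P, Q, hP, hPQ, hPζ⟩ := exists_bass_polynomial (m := Nat.totient n) hn1 hjn (by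
    intro i hi
    have := (Nat.ModEq.pow_totient hi).dvd
    push_cast at this
    exact this)
  obtain ⟨ζ, hζ⟩ : ∃ ζ : ℂ, IsPrimitiveRoot ζ n :=
    ⟨_, Complex.isPrimitiveRoot_exp n (by omega)⟩
  have hprim : ∀ i : ℕ, IsPrimitiveRoot (ζ ^ j ^ i) n := fun i =>
    hζ.pow_of_coprime _ (Nat.Coprime.pow_left i hjn)
  have hpos : ∀ i : ℕ, 0 < ‖ζ ^ j ^ i - 1‖ := fun i =>
    norm_pos_iff.2 (sub_ne_zero.2 ((hprim i).ne_one hn1))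
  have hcard : Nat.card G ≠ 0 := Nat.card_pos.ne'
  have hconst : ∀ i : ℕ, ‖aeval (ζ ^ j ^ i) P‖ = ‖aeval ζ P‖ := by
    intro i
    induction i with
    | zero => simp
    | succ i ih =>
      have h1 := H.aeval_pow_card_eq hj.symm hP (hn ▸ hPQ) (ζ := ζ ^ j ^ i)
        (hn ▸ (hprim i).pow_eq_one)
      rw [← pow_mul, ← pow_succ] at h1
      have h2 := congrArg norm h1
      rw [norm_pow, norm_pow] at h2
      rw [← ih]
      exact (pow_left_inj₀ (norm_nonneg _) (norm_nonneg _) hcard).1 h2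
  set r := ‖ζ ^ j - 1‖ / ‖ζ - 1‖ with hr
  have hd0 : 0 < ‖ζ - 1‖ := by simpa using hpos 0
  have hr0 : 0 ≤ r := by positivity
  have hstep : ∀ i : ℕ, ‖ζ ^ j ^ (i + 1) - 1‖ = r * ‖ζ ^ j ^ i - 1‖ := by
    have hval : ∀ i : ℕ, ‖aeval ζ P‖ = (‖ζ ^ j ^ (i + 1) - 1‖ / ‖ζ ^ j ^ i - 1‖) ^ n.totient := by
      intro i
      have h1 := congrArg norm (hPζ (ζ ^ j ^ i) (hprim i).pow_eq_one ((hprim i).ne_one hn1))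
      rw [norm_mul, hconst, norm_pow, norm_pow, ← pow_mul, ← pow_succ] at h1
      rw [div_pow, eq_div_iff (pow_ne_zero _ (hpos i).ne'), h1]
    intro i
    have h1 := (hval i).symm.trans (hval 0)
    rw [zero_add, pow_one, pow_zero, pow_one] at h1
    have h2 := (pow_left_inj₀ (by positivity) hr0 hφ.ne').1 h1
    rw [← h2, div_mul_cancel₀ _ (hpos i).ne']
  have hgeom : ∀ i : ℕ, ‖ζ ^ j ^ i - 1‖ = r ^ i * ‖ζ - 1‖ := by
    intro i
    induction i with
    | zero => simp
    -- The progression returns to its start at `i = φ(n)` by Euler's theorem, which forces `r = 1`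
    -- below.
    | succ i ih => rw [hstep, ih, pow_succ]; ring
  have hr1 : r = 1 := by
    have h1 := hgeom n.totient
    have h2 : ζ ^ j ^ n.totient = ζ := by
      conv_rhs => rw [← pow_one ζ]
      rw [← pow_mod_orderOf ζ, ← hζ.eq_orderOf, Nat.ModEq.pow_totient hjn, hζ.eq_orderOf,
        pow_mod_orderOf]
    rw [h2] at h1
    exact (pow_eq_one_iff_of_nonneg hr0 hφ.ne').1
      (mul_right_cancel₀ hd0.ne' (h1.symm.trans (one_mul _).symm))
  have hnorm : ‖ζ ^ j - 1‖ = ‖ζ - 1‖ := by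
    rw [hr, div_eq_one_iff_eq hd0.ne'] at hr1; exact hr1
  have hζ1 : ‖ζ‖ = 1 := hζ.norm'_eq_one (by omega)
  rcases eq_or_eq_inv_of_norm_sub_one_eq (by rw [norm_pow, hζ1, one_pow]) hζ1 hnorm with h | h
  · left
    obtain ⟨i, rfl⟩ := Nat.exists_eq_add_one_of_ne_zero
      (show j ≠ 0 by rintro rfl; simp at hjn; omega)
    have h1 : ζ ^ i = 1 :=
      mul_right_cancel₀ (hζ.ne_zero (by omega)) (by rw [← pow_succ, h, one_mul])
    rw [hζ.pow_eq_one_iff_dvd, hn, orderOf_dvd_iff_pow_eq_one] at h1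
    rw [← hj, pow_succ, h1, one_mul]
  · right
    have h1 : ζ ^ (j + 1) = 1 := by
      rw [pow_succ, h, inv_mul_cancel₀ (hζ.ne_zero (by omega))]
    rw [hζ.pow_eq_one_iff_dvd, hn, orderOf_dvd_iff_pow_eq_one, pow_succ] at h1
    rw [← hj, eq_inv_of_mul_eq_one_left h1]

end Conj

/-- An element `z` of odd prime order would commute with both members of a non-commuting pair `a`,
`b`. Then `b` sends `a * z` to `a⁻¹ * z`, which is neither `a * z` nor its inverse. -/
theorem UnitsNormalize.isHamiltonianTwoGroup {G : Type*} [Group G] [Finite G]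
    (H : UnitsNormalize G) (hG : ∃ a b : G, a * b ≠ b * a) : IsHamiltonianTwoGroup G := by
  refine ⟨⟨hG, H.normal⟩, ?_⟩
  obtain ⟨a, b, hab⟩ := hG
  have hinv : ∀ x y : G, x * y ≠ y * x → y * x * y⁻¹ = x⁻¹ := by
    intro x y hxy
    refine (H.conj_eq_or_eq_inv x y).resolve_left fun h => hxy ?_
    rw [← h, inv_mul_cancel_right, h]
  have hsq : ∀ x y : G, x * y ≠ y * x → x⁻¹ ≠ x := by
    intro x y hxy h
    have h1 := hinv x y hxy
    rw [h, mul_inv_eq_iff_eq_mul] at h1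
    exact hxy h1.symm
  rw [IsPGroup.iff_card]
  refine ⟨_, Nat.eq_prime_pow_of_unique_prime_dvd Nat.card_pos.ne' fun {p} hp hpG => ?_⟩
  by_contra hp2
  have := Fact.mk hp
  obtain ⟨z, hz⟩ := exists_prime_orderOf_dvd_card' p hpG
  have hodd : Odd p := hp.odd_of_ne_two hp2
  have hz2 : z⁻¹ ≠ z := by
    intro h
    have h1 : z ^ 2 = 1 := by rw [pow_two]; nth_rw 1 [← h]; exact inv_mul_cancel z
    have h2 := orderOf_dvd_of_pow_eq_one h1
    rw [hz, Nat.prime_dvd_prime_iff_eq hp Nat.prime_two] at h2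
    exact hp2 h2
  have hcomm : ∀ x y : G, x * y ≠ y * x → Commute z x := by
    intro x y hxy
    by_contra hzx
    -- Odd powers of an inverting element still invert. Since `z` has odd order, `1` is such a
    -- power, so `x = x⁻¹`.
    have h1 : ∀ i : ℕ, z ^ (2 * i + 1) * x * (z ^ (2 * i + 1))⁻¹ = x⁻¹ := by
      have h0 := hinv x z (fun h => hzx h.symm)
      intro i
      induction i with
      | zero => simpa using h0
      | succ i ih =>
        have : z ^ (2 * (i + 1) + 1) * x * (z ^ (2 * (i + 1) + 1))⁻¹ =
            z * (z * (z ^ (2 * i + 1) * x * (z ^ (2 * i + 1))⁻¹) * z⁻¹) * z⁻¹ := by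
          rw [show 2 * (i + 1) + 1 = 1 + 1 + (2 * i + 1) by ring, pow_add, pow_add]; group
        rw [this, ih, ← conj_inv, h0, inv_inv, h0]
    obtain ⟨i, hi⟩ := hodd
    have h2 := h1 i
    rw [← hi, ← hz, pow_orderOf_eq_one] at h2
    exact hsq x y hxy (by simpa using h2.symm)
  have hza := hcomm a b hab
  have hzb := hcomm b a (Ne.symm hab)
  have hc : b * (a * z) * b⁻¹ = a⁻¹ * z := by
    have : b * (a * z) * b⁻¹ = b * a * b⁻¹ * z := by
      have := hzb.inv_right.eq
      simp only [mul_assoc]; rw [this]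
    rw [this, hinv a b hab]
  rcases H.conj_eq_or_eq_inv (a * z) b with h | h
  · rw [hc, mul_left_inj] at h
    exact hsq a b hab h
  · rw [hc, ← hza.eq, mul_inv_rev, mul_right_inj] at h
    exact hz2 h.symm

/-! ### Structure of Hamiltonian 2-groups -/

section Structure

/-- `a` and `b` generate a quaternion group of order `8`. -/
structure IsQuaternionPair {G : Type*} [Group G] (a b : G) : Prop where
  not_comm : a * b ≠ b * a
  sq_eq : b ^ 2 = a ^ 2
  pow_four : a ^ 4 = 1
  conj : b * a * b⁻¹ = a⁻¹

theorem eq_pow_of_mem_zpowers_of_sq {G : Type*} [Group G] {x c : G} {k : ℕ}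
    (hx : orderOf x = 2 ^ (k + 1)) (hc : c ∈ Subgroup.zpowers x) (hc1 : c ≠ 1) (hc2 : c ^ 2 = 1) :
    c = x ^ 2 ^ k := by
  have hfin : IsOfFinOrder x := orderOf_pos_iff.1 (by rw [hx]; positivity)
  obtain ⟨i, rfl⟩ := hfin.mem_powers_iff_mem_zpowers.2 hc
  simp only at hc1 hc2 ⊢
  rw [← pow_mul, ← orderOf_dvd_iff_pow_eq_one, hx, pow_succ,
    Nat.mul_dvd_mul_iff_right two_pos] at hc2
  obtain ⟨t, rfl⟩ := hc2
  have h1 : (x ^ 2 ^ k) ^ 2 = 1 := by rw [← pow_mul, ← pow_succ, ← hx, pow_orderOf_eq_one]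
  rw [pow_mul] at hc1 ⊢
  rcases Nat.even_or_odd' t with ⟨s, rfl | rfl⟩
  · rw [pow_mul, h1, one_pow] at hc1; exact absurd rfl hc1
  · rw [pow_succ, pow_mul, h1, one_pow, one_mul]

/-- Take `a` non-central of least order and `b` of least order not commuting with `a`. Their
commutator `c` lies in `⟨a⟩ ∩ ⟨b⟩`, and `c ^ 2 = 1` because `a ^ 2` is central by minimality. So `c`
is the unique involution of both cyclic groups, and minimality forces both orders to be 4. -/
theorem IsHamiltonianTwoGroup.exists_isQuaternionPair {G : Type*} [Group G] [Finite G]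
    (hG : IsHamiltonianTwoGroup G) : ∃ a b : G, IsQuaternionPair a b := by
  obtain ⟨⟨⟨a₀, b₀, hab₀⟩, hnorm⟩, hp⟩ := hG
  obtain ⟨a, ⟨b₁, hab₁⟩, hamin⟩ := (Set.toFinite {a : G | ∃ b, a * b ≠ b * a}).exists_minimalFor
    orderOf _ ⟨a₀, b₀, hab₀⟩
  obtain ⟨b, hab, hbmin⟩ := (Set.toFinite {b : G | a * b ≠ b * a}).exists_minimalFor
    orderOf _ ⟨b₁, hab₁⟩
  simp only [Set.mem_ofPred_eq] at hab hamin hbmin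
  have hex : ∀ x : G, x ≠ 1 → ∃ k, orderOf x = 2 ^ (k + 1) := by
    intro x hx
    obtain ⟨k, hk⟩ := IsPGroup.iff_orderOf.1 hp x
    cases k with
    | zero => exact absurd (orderOf_eq_one_iff.1 hk) hx
    | succ k => exact ⟨k, hk⟩
  obtain ⟨r, hr⟩ := hex a (by rintro rfl; simp at hab)
  obtain ⟨s, hs⟩ := hex b (by rintro rfl; simp at hab)
  have hsqlt : ∀ (x : G) (k : ℕ), orderOf x = 2 ^ (k + 1) → orderOf (x ^ 2) < orderOf x := by
    intro x k hk
    have h1 : orderOf (x ^ 2) ∣ 2 ^ k := by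
      rw [orderOf_dvd_iff_pow_eq_one, ← pow_mul, ← pow_succ', ← hk, pow_orderOf_eq_one]
    rw [hk]
    exact (Nat.le_of_dvd (by positivity) h1).trans_lt (Nat.pow_lt_pow_right (by norm_num) (by simp))
  have ha2 : ∀ x, Commute (a ^ 2) x := by
    intro x
    by_contra hx
    exact (hsqlt a r hr).not_ge (hamin ⟨x, hx⟩ (hsqlt a r hr).le)
  have hb2 : Commute (b ^ 2) a := by
    by_contra hx
    exact (hsqlt b s hs).not_ge (hbmin (fun h => hx h.symm) (hsqlt b s hs).le)
  obtain ⟨c, hc⟩ : ∃ c, c = b * a * b⁻¹ * a⁻¹ := ⟨_, rfl⟩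
  have hca : c ∈ Subgroup.zpowers a := by
    rw [hc]
    exact mul_mem ((hnorm _).conj_mem _ (Subgroup.mem_zpowers a) b)
      (inv_mem (Subgroup.mem_zpowers a))
  have hcb : c ∈ Subgroup.zpowers b := by
    rw [hc, mul_assoc, mul_assoc, ← mul_assoc a]
    exact mul_mem (Subgroup.mem_zpowers b)
      ((hnorm _).conj_mem _ (inv_mem (Subgroup.mem_zpowers b)) a)
  have hcoma : Commute c a := by
    obtain ⟨i, rfl⟩ := hca; exact (Commute.refl a).zpow_left i
  have hcomb : Commute c b := by
    obtain ⟨i, rfl⟩ := hcb; exact (Commute.refl b).zpow_left i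
  have hconj : b * a * b⁻¹ = c * a := by rw [hc, inv_mul_cancel_right]
  have hc1 : c ≠ 1 := by
    intro h
    rw [h, one_mul, mul_inv_eq_iff_eq_mul] at hconj
    exact hab hconj.symm
  have hc2 : c ^ 2 = 1 := by
    have h1 : b * a ^ 2 * b⁻¹ = c ^ 2 * a ^ 2 := by rw [← conj_pow, hconj, hcoma.mul_pow]
    rw [← (ha2 b).eq, mul_inv_cancel_right] at h1
    exact right_eq_mul.1 h1
  have hcr := eq_pow_of_mem_zpowers_of_sq hr hca hc1 hc2
  have hcs := eq_pow_of_mem_zpowers_of_sq hs hcb hc1 hc2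
  have hrs : r ≤ s := by
    by_contra! hlt
    have h1 : orderOf b < orderOf a := by
      rw [hr, hs]; exact Nat.pow_lt_pow_right (by norm_num) (by omega)
    exact h1.not_ge (hamin ⟨a, fun h => hab h.symm⟩ h1.le)
  -- As `d * a` does not commute with `b`, its order is at least that of `a`, namely `2 ^ (r + 1)`.
  -- Suitable `d` contradict this unless `r = s = 1`.
  have hnot : ∀ d ∈ Subgroup.zpowers b, (d * a) ^ 2 ^ r ≠ 1 := by
    rintro d ⟨i, rfl⟩ h1
    have h2 : orderOf (b ^ i * a) < orderOf a := by
      have h3 := orderOf_dvd_of_pow_eq_one h1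
      rw [hr]
      exact (Nat.le_of_dvd (by positivity) h3).trans_lt
        (Nat.pow_lt_pow_right (by norm_num) (by simp))
    refine h2.not_ge (hamin ⟨b, fun h => hab ?_⟩ h2.le)
    have h4 : b * b ^ i = b ^ i * b := ((Commute.refl b).zpow_right i).eq
    rw [mul_assoc, ← mul_assoc b, h4, mul_assoc] at h
    exact mul_left_cancel h
  have hrs' : r = s := by
    by_contra hne
    have hd : Commute ((b ^ 2 ^ (s - r))⁻¹) a := by
      obtain ⟨t, ht⟩ : ∃ t, s - r = t + 1 := ⟨s - r - 1, by omega⟩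
      rw [ht, pow_succ', pow_mul]
      exact (hb2.pow_left _).inv_left
    refine hnot _ (inv_mem (Subgroup.npow_mem_zpowers b (2 ^ (s - r)))) ?_
    rw [hd.mul_pow, inv_pow, ← pow_mul, ← pow_add, Nat.sub_add_cancel hrs, ← hcs, ← hcr,
      inv_mul_cancel]
  subst hrs'
  have hr0 : r ≠ 0 := by
    rintro rfl
    rw [pow_zero, pow_one] at hcr
    exact hab (hcr ▸ hcomb.eq)
  have hr1 : r = 1 := by
    by_contra hne
    obtain ⟨t, rfl⟩ : ∃ t, r = t + 2 := ⟨r - 2, by omega⟩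
    refine hnot _ (inv_mem (Subgroup.mem_zpowers b)) ?_
    -- For `r ≥ 2` the factor `c` disappears on raising to the even power `2 ^ (r - 1)`, leaving `(b
    -- ^ 2 ^ r)⁻¹ * a ^ 2 ^ r = c⁻¹ * c = 1`.
    have h1 : (b⁻¹ * a) ^ 2 = (b ^ 2)⁻¹ * (c * a ^ 2) := by
      have h2 : a * b⁻¹ = b⁻¹ * (c * a) := by rw [← hconj]; group
      calc (b⁻¹ * a) ^ 2 = b⁻¹ * (a * b⁻¹) * a := by rw [pow_two]; simp only [mul_assoc]
        _ = b⁻¹ * b⁻¹ * (c * (a * a)) := by rw [h2]; simp only [mul_assoc]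
        _ = _ := by rw [pow_two, pow_two, mul_inv_rev]
    have h3 : Commute ((b ^ 2)⁻¹) (c * a ^ 2) :=
      (((hcomb.pow_right 2).symm).mul_right (ha2 _).symm).inv_left
    have h4 : Commute c (a ^ 2) := (ha2 c).symm
    rw [pow_succ' 2 (t + 1), pow_mul, h1, h3.mul_pow, h4.mul_pow, inv_pow, ← pow_mul, ← pow_mul,
      ← pow_succ', ← hcs, ← hcr, pow_succ', pow_mul c, hc2, one_pow, one_mul, inv_mul_cancel]
  subst hr1
  rw [pow_one] at hcr hcs
  refine ⟨a, b, hab, by rw [← hcr, ← hcs], by rw [← pow_orderOf_eq_one a, hr]; rfl, ?_⟩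
  rw [hconj, eq_inv_iff_mul_eq_one, mul_assoc, ← pow_two, ← hcr, ← pow_two, hc2]

namespace IsQuaternionPair

variable {G : Type*} [Group G] {a b : G}

theorem sq_ne_one (h : IsQuaternionPair a b) : a ^ 2 ≠ 1 := by
  intro h2
  have h1 : a⁻¹ = a := inv_eq_of_mul_eq_one_left (by rw [← pow_two, h2])
  have h3 := h.conj
  rw [h1, mul_inv_eq_iff_eq_mul] at h3
  exact h.not_comm h3.symm

theorem pow_mul_right (h : IsQuaternionPair a b) (k : ℕ) : a ^ k * b = b * (a ^ k)⁻¹ := by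
  have h1 : b * (a ^ k)⁻¹ * b⁻¹ = a ^ k := by
    rw [← conj_inv, ← conj_pow, h.conj, inv_pow, inv_inv]
  rw [mul_inv_eq_iff_eq_mul] at h1
  exact h1.symm

theorem symm (h : IsQuaternionPair a b) : IsQuaternionPair b a := by
  refine ⟨h.not_comm.symm, h.sq_eq.symm, ?_, ?_⟩
  · rw [show 4 = 2 * 2 from rfl, pow_mul, h.sq_eq, ← pow_mul, h.pow_four]
  · have h1 : a * b = b * a⁻¹ := by simpa using h.pow_mul_right 1
    have h2 : a⁻¹ * a⁻¹ = b * b := by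
      rw [← pow_two b, h.sq_eq, ← mul_inv_rev, inv_eq_iff_mul_eq_one, ← pow_two, ← pow_add,
        h.pow_four]
    have h3 : b ^ 4 = 1 := by
      rw [show 4 = 2 * 2 from rfl, pow_mul, h.sq_eq, ← pow_mul, h.pow_four]
    rw [h1, mul_assoc, h2, eq_inv_iff_mul_eq_one, ← h3]
    simp only [pow_succ, pow_zero, one_mul, mul_assoc]

/-- The homomorphism from the quaternion group given by a quaternion pair. -/
def hom (h : IsQuaternionPair a b) : QuaternionGroup 2 →* G :=
  have hadd : ∀ i j : ZMod (2 * 2), a ^ (i + j).val = a ^ i.val * a ^ j.val := by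
    intro i j
    rw [ZMod.val_add, ← pow_add, ← pow_eq_pow_mod _ h.pow_four]
  have hneg : ∀ i : ZMod (2 * 2), a ^ (-i).val = (a ^ i.val)⁻¹ := by
    intro i
    rw [eq_inv_iff_mul_eq_one, ← hadd, neg_add_cancel, ZMod.val_zero, pow_zero]
  { toFun := fun q => match q with
      | .a i => a ^ i.val
      | .xa i => b * a ^ i.val
    map_one' := by
      change a ^ (0 : ZMod (2 * 2)).val = 1
      rw [ZMod.val_zero, pow_zero]
    map_mul' := by
      rintro (i | i) (j | j)
      · simp only [QuaternionGroup.a_mul_a, hadd]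
      · simp only [QuaternionGroup.a_mul_xa, sub_eq_neg_add, hadd, hneg, ← mul_assoc,
          h.pow_mul_right]
      · simp only [QuaternionGroup.xa_mul_a, hadd, ← mul_assoc]
      · have h2 : a ^ ((2 : ℕ) : ZMod (2 * 2)).val = b * b := by
          rw [← pow_two b, h.sq_eq]; rfl
        simp only [QuaternionGroup.xa_mul_xa, add_sub_assoc, sub_eq_neg_add j, hadd, hneg, h2]
        rw [mul_assoc b (a ^ i.val), ← mul_assoc (a ^ i.val) b, h.pow_mul_right]
        simp only [mul_assoc] }

@[simp]
theorem hom_a (h : IsQuaternionPair a b) (i : ZMod (2 * 2)) : h.hom (.a i) = a ^ i.val := rfl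

@[simp]
theorem hom_xa (h : IsQuaternionPair a b) (i : ZMod (2 * 2)) : h.hom (.xa i) = b * a ^ i.val := rfl

theorem eq_one_or_eq_of_hom_commute (h : IsQuaternionPair a b) {q : QuaternionGroup 2}
    (ha : Commute (h.hom q) a) (hb : Commute (h.hom q) b) : q = 1 ∨ q = .a 2 := by
  have hne : a⁻¹ ≠ a := by
    intro h1
    exact h.sq_ne_one (by rw [pow_two]; nth_rw 1 [← h1]; exact inv_mul_cancel a)
  rcases q with i | i
  · rw [hom_a] at hb
    change ZMod 4 at i
    fin_cases i
    · left; rfl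
    · exfalso
      change Commute (a ^ 1) b at hb
      exact h.not_comm (by simpa using hb.eq)
    · right; rfl
    · exfalso
      have h3 : a ^ 3 = a⁻¹ := eq_inv_of_mul_eq_one_left (by rw [← pow_succ, h.pow_four])
      change Commute (a ^ 3) b at hb
      rw [h3] at hb
      exact h.not_comm (Commute.inv_left_iff.1 hb).eq
  · exfalso
    rw [hom_xa] at ha
    have h4 : Commute (b * a ^ i.val * (a ^ i.val)⁻¹) a :=
      ha.mul_left ((Commute.refl a).pow_left _).inv_left
    rw [mul_inv_cancel_right] at h4
    exact h.not_comm h4.symm.eq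

theorem conj_eq_or_eq_inv {x y : G} (hx4 : x ^ 4 = 1)
    (h : y * x * y⁻¹ ∈ Subgroup.zpowers x) : y * x * y⁻¹ = x ∨ y * x * y⁻¹ = x⁻¹ := by
  have hfin : IsOfFinOrder x := isOfFinOrder_iff_pow_eq_one.2 ⟨4, by norm_num, hx4⟩
  obtain ⟨i, hi⟩ := hfin.mem_powers_iff_mem_zpowers.2 h
  simp only at hi
  rw [pow_eq_pow_mod i hx4] at hi
  have hlt : i % 4 < 4 := Nat.mod_lt _ (by norm_num)
  have h1 : y * x * y⁻¹ = 1 → y * x * y⁻¹ = x := by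
    intro h
    rw [h, conj_eq_one_iff.1 h]
  interval_cases i % 4
  · left; exact h1 (by rw [← hi, pow_zero])
  · left; rw [← hi, pow_one]
  · left
    refine h1 ?_
    have h2 : (y * x * y⁻¹) ^ 2 = 1 := by rw [← hi, ← pow_mul, hx4]
    rw [conj_pow, conj_eq_one_iff] at h2
    rw [← hi, h2]
  · right; rw [← hi]; exact eq_inv_of_mul_eq_one_left (by rw [← pow_succ, hx4])

/-- If `x` centralizes the pair and `x ^ 4 = 1`, then `a` conjugates `b * x` to `b⁻¹ * x`. By
normality this is `b * x` or its inverse; the former gives `b ^ 2 = 1`, so `x = x⁻¹`. Higher 2-power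
orders descend to this case. -/
theorem sq_eq_one_of_commute (h : IsQuaternionPair a b) (hp : IsPGroup 2 G)
    (hn : ∀ H : Subgroup G, H.Normal) {g : G} (hga : Commute g a) (hgb : Commute g b) :
    g ^ 2 = 1 := by
  have key : ∀ x : G, Commute x a → Commute x b → x ^ 4 = 1 → x ^ 2 = 1 := by
    intro x hxa hxb hx4
    have h1 : a * (b * x) * a⁻¹ = b⁻¹ * x := by
      rw [← h.symm.conj]
      have := hxa.inv_right.eq
      simp only [mul_assoc]; rw [this]
    have hbx4 : (b * x) ^ 4 = 1 := by rw [hxb.symm.mul_pow, h.symm.pow_four, hx4, one_mul]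
    rcases conj_eq_or_eq_inv hbx4
      ((hn _).conj_mem _ (Subgroup.mem_zpowers (b * x)) a) with h2 | h2
    · rw [h1, mul_left_inj] at h2
      exact absurd (by rw [pow_two]; nth_rw 1 [← h2]; exact inv_mul_cancel b) h.symm.sq_ne_one
    · rw [h1, mul_inv_rev, hxb.inv_inv.eq, mul_right_inj] at h2
      rw [pow_two]; nth_rw 1 [h2]; exact inv_mul_cancel x
  obtain ⟨k, hk⟩ := hp.exists_pow_pow_eq_one g
  induction k with
  | zero => rw [pow_zero, pow_one] at hk; rw [hk, one_pow]
  | succ k ih =>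
    cases k with
    | zero => rwa [zero_add, pow_one] at hk
    | succ k =>
      refine ih ?_
      have h1 := key (g ^ 2 ^ k) (hga.pow_left _) (hgb.pow_left _)
        (by rw [← pow_mul, ← hk]; congr 1; ring)
      rwa [← pow_mul, ← pow_succ] at h1

theorem exists_mulEquiv [Finite G] (h : IsQuaternionPair a b) (hp : IsPGroup 2 G)
    (hn : ∀ H : Subgroup G, H.Normal) :
    ∃ E : Subgroup G, (∀ e : E, e ^ 2 = 1) ∧ Nonempty (G ≃* QuaternionGroup 2 × E) := by
  let C : Subgroup G := Subgroup.centralizer {a, b}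
  have hC : ∀ {g : G}, g ∈ C ↔ Commute g a ∧ Commute g b := by
    intro g
    simp only [C, Subgroup.mem_centralizer_iff, Set.mem_insert_iff, Set.mem_singleton_iff,
      forall_eq_or_imp, forall_eq]
    exact ⟨fun h => ⟨h.1.symm, h.2.symm⟩, fun h => ⟨h.1.symm, h.2.symm⟩⟩
  have hC2 : ∀ {g : G}, g ∈ C → g * g = 1 := by
    intro g hg
    rw [← pow_two]
    exact h.sq_eq_one_of_commute hp hn (hC.1 hg).1 (hC.1 hg).2
  have ha2 : a ^ 2 ∈ C := by
    refine hC.2 ⟨(Commute.refl a).pow_left 2, ?_⟩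
    rw [← h.sq_eq]; exact (Commute.refl b).pow_left 2
  -- As `C` has exponent 2, a subgroup maximal among those avoiding `a ^ 2` is a complement of `⟨a ^
  -- 2⟩` in `C`.
  obtain ⟨E, ⟨hEC, hE2⟩, hEmax⟩ := (Set.toFinite {E : Subgroup G | E ≤ C ∧ a ^ 2 ∉ E}).exists_maximal
    ⟨⊥, bot_le, fun h' => h.sq_ne_one (Subgroup.mem_bot.1 h')⟩
  have hcomm : ∀ (q : QuaternionGroup 2) (e : E), Commute (h.hom q) (E.subtype e) := by
    intro q e
    have he := hC.1 (hEC e.2)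
    rcases q with i | i
    · exact (he.1.pow_right _).symm
    · exact (he.2.mul_right (he.1.pow_right _)).symm
  have hmem : ∀ g ∈ C, g ∈ E ∨ a ^ 2 * g ∈ E := by
    intro g hg
    by_contra! hnot
    have hle : Subgroup.zpowers g ⊔ E ≤ C := sup_le (Subgroup.zpowers_le.2 hg) hEC
    have ha2E : a ^ 2 ∈ Subgroup.zpowers g ⊔ E := by
      by_contra h'
      exact hnot.1 (hEmax ⟨hle, h'⟩ le_sup_right
        (Subgroup.mem_sup_left (Subgroup.mem_zpowers g)))
    have := hn E
    obtain ⟨y, ⟨i, rfl⟩, z, hz, hyz⟩ := Subgroup.mem_sup_of_normal_right.1 ha2E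
    simp only at hyz
    have hgg : g ^ (2 : ℤ) = 1 := by rw [zpow_two, hC2 hg]
    have hga : Commute (a ^ 2) g := ((hC.1 hg).1.pow_right 2).symm
    rcases Int.even_or_odd' i with ⟨t, rfl | rfl⟩
    · rw [zpow_mul, hgg, one_zpow, one_mul] at hyz
      exact hE2 (hyz ▸ hz)
    · rw [zpow_add, zpow_mul, hgg, one_zpow, one_mul, zpow_one] at hyz
      refine hnot.2 ?_
      rwa [hga.eq, ← hyz, ← mul_assoc, hC2 hg, one_mul]
  let f := h.hom.noncommCoprod E.subtype hcomm
  have hf1 : ∀ q, h.hom q ∈ f.range := fun q => ⟨(q, 1), by simp [f]⟩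
  have hf2 : ∀ e ∈ E, e ∈ f.range := fun e he => ⟨(1, ⟨e, he⟩), by simp [f]⟩
  have hfa : a ∈ f.range := by
    have := hf1 (.a 1)
    rw [hom_a] at this
    change a ^ 1 ∈ f.range at this
    rwa [pow_one] at this
  have hfb : b ∈ f.range := by
    have := hf1 (.xa 0)
    rwa [hom_xa, ZMod.val_zero, pow_zero, mul_one] at this
  have hfC : ∀ g ∈ C, g ∈ f.range := by
    intro g hg
    rcases hmem g hg with h' | h'
    · exact hf2 g h'
    · exact (Subgroup.mul_mem_cancel_left _ (pow_mem hfa 2)).1 (hf2 _ h')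
  -- Every `g` fixes or inverts each of `a` and `b`. Multiplying by `b` corrects the action on `a`,
  -- and then multiplying by `a` corrects the action on `b`, which lands in `C`.
  have hfa' : ∀ g, Commute g a → g ∈ f.range := by
    intro g hg
    rcases conj_eq_or_eq_inv h.symm.pow_four
      ((hn _).conj_mem _ (Subgroup.mem_zpowers b) g) with h' | h'
    · exact hfC g (hC.2 ⟨hg, mul_inv_eq_iff_eq_mul.1 h'⟩)
    · refine (Subgroup.mul_mem_cancel_left _ hfa).1 (hfC _ (hC.2 ⟨(Commute.refl a).mul_left hg, ?_⟩))
      have h2 : a * g * b * (a * g)⁻¹ = a * (g * b * g⁻¹) * a⁻¹ := by group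
      rw [h', ← conj_inv, h.symm.conj, inv_inv] at h2
      exact mul_inv_eq_iff_eq_mul.1 h2
  have hsurj : Function.Surjective f := by
    rw [← MonoidHom.range_eq_top, eq_top_iff]
    intro g _
    rcases conj_eq_or_eq_inv h.pow_four
      ((hn _).conj_mem _ (Subgroup.mem_zpowers a) g) with h' | h'
    · exact hfa' g (mul_inv_eq_iff_eq_mul.1 h')
    · refine (Subgroup.mul_mem_cancel_left _ hfb).1 (hfa' _ ?_)
      have h2 : b * g * a * (b * g)⁻¹ = b * (g * a * g⁻¹) * b⁻¹ := by group
      rw [h', ← conj_inv, h.conj, inv_inv] at h2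
      exact mul_inv_eq_iff_eq_mul.1 h2
  have hinj : Function.Injective f := by
    rw [injective_iff_map_eq_one]
    rintro ⟨q, e⟩ hqe
    have h1 : h.hom q * (e : G) = 1 := hqe
    have h2 : h.hom q ∈ E := by rw [eq_inv_of_mul_eq_one_left h1]; exact inv_mem e.2
    have h3 := hC.1 (hEC h2)
    have hq : q = 1 := by
      refine (h.eq_one_or_eq_of_hom_commute h3.1 h3.2).resolve_right ?_
      rintro rfl
      exact hE2 h2
    subst hq
    rw [map_one, one_mul] at h1
    exact Prod.ext rfl (Subtype.ext h1)
  refine ⟨E, fun e => ?_, ⟨(MulEquiv.ofBijective f ⟨hinj, hsurj⟩).symm⟩⟩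
  rw [pow_two]
  exact Subtype.ext (hC2 (hEC e.2))

end IsQuaternionPair

/-- In `Q₈` conjugation fixes or inverts each element, and in `E` every element is its own inverse,
so the same dichotomy holds in the product. -/
theorem isHamiltonianTwoGroup_of_mulEquiv {G E : Type*} [Group G] [Group E]
    (hE : ∀ e : E, e ^ 2 = 1) (φ : G ≃* QuaternionGroup 2 × E) : IsHamiltonianTwoGroup G := by
  have hinv : ∀ e : E, e⁻¹ = e := fun e => inv_eq_of_mul_eq_one_left (by rw [← pow_two, hE])
  have hcomm : ∀ e f : E, e * f = f * e := fun e f => by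
    rw [← hinv (e * f), mul_inv_rev, hinv, hinv]
  have hQ : ∀ p q : QuaternionGroup 2, p * q * p⁻¹ = q ∨ p * q * p⁻¹ = q⁻¹ := by decide
  have hQ4 : ∀ q : QuaternionGroup 2, q ^ 4 = 1 := by decide
  refine ⟨⟨⟨φ.symm (.a 1, 1), φ.symm (.xa 0, 1), fun h => ?_⟩, fun H => ⟨fun h hh g => ?_⟩⟩, ?_⟩
  · rw [← map_mul, ← map_mul, EmbeddingLike.apply_eq_iff_eq] at h
    have h1 : (.a 1 * .xa 0 : QuaternionGroup 2) ≠ .xa 0 * .a 1 := by decide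
    exact h1 (congrArg Prod.fst h)
  · have h1 : g * h * g⁻¹ = h ∨ g * h * g⁻¹ = h⁻¹ := by
      have h2 : (φ (g * h * g⁻¹)).2 = (φ h).2 := by
        simp only [map_mul, map_inv, Prod.snd_mul, Prod.snd_inv]
        rw [hcomm (φ g).2, mul_inv_cancel_right]
      refine (hQ (φ g).1 (φ h).1).imp (fun h3 => ?_) (fun h3 => ?_) <;>
        refine φ.injective (Prod.ext ?_ ?_)
      · simpa using h3
      · exact h2
      · simpa using h3
      · rw [h2, map_inv, Prod.snd_inv, hinv]
    rcases h1 with h1 | h1 <;> rw [h1]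
    · exact hh
    · exact inv_mem hh
  · rw [isPGroup_iff_pow_pow_eq_one]
    refine fun g => ⟨2, φ.injective ?_⟩
    rw [map_pow, map_one]
    refine Prod.ext (hQ4 _) ?_
    change (φ g).2 ^ (2 * 2) = 1
    rw [pow_mul, hE]

end Structure

/-! ### Triviality of the units of `ℤ[Q₈ × E]` -/

section Units

open MonoidAlgebra

/-- Every unit of `ℤG` has exactly one nonzero coefficient, and that coefficient is `±1`. -/
def HasTrivialUnits (G : Type*) [Group G] [Fintype G] : Prop :=
  ∀ u w : MonoidAlgebra ℤ G, u * w = 1 → ∑ g, u.coeff g ^ 2 = 1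

theorem HasTrivialUnits.of_mulEquiv {A B : Type*} [Group A] [Fintype A] [Group B] [Fintype B]
    (hA : HasTrivialUnits A) (e : B ≃* A) : HasTrivialUnits B := by
  intro u w huw
  have h := hA (mapDomainRingEquiv ℤ e u) (mapDomainRingEquiv ℤ e w)
    (by rw [← map_mul, huw, map_one])
  rw [← h, ← e.toEquiv.sum_comp]
  refine Finset.sum_congr rfl fun g _ => ?_
  simp [coeff_mapDomainRingEquiv]

/-- The ring homomorphism `ℤ[A × C] → ℤA` given by a character of `C`. -/
noncomputable def characterMap (A : Type*) {C : Type*} [Group A] [Group C] (ε : C →* ℤ) :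
    MonoidAlgebra ℤ (A × C) →ₐ[ℤ] MonoidAlgebra ℤ A :=
  MonoidAlgebra.lift ℤ _ (A × C)
    ((MonoidAlgebra.singleHom (R := ℤ) (M := A)).comp
      ((ε.comp (MonoidHom.snd A C)).prod (MonoidHom.fst A C)))

theorem coeff_characterMap {A C : Type*} [Group A] [Group C] [Fintype C] (ε : C →* ℤ)
    (u : MonoidAlgebra ℤ (A × C)) (g : A) :
    (characterMap A ε u).coeff g = ∑ z, ε z * u.coeff (g, z) := by
  classical
  induction u using MonoidAlgebra.induction_linear with
  | zero => simp
  | add p q hp hq => simp [hp, hq, mul_add, Finset.sum_add_distrib]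
  | single x r =>
    obtain ⟨y, z⟩ := x
    simp only [characterMap, lift_single, MonoidHom.comp_apply, MonoidHom.prod_apply,
      MonoidHom.coe_snd, MonoidHom.coe_fst, coeff_smul_apply, coeff_single,
      Finsupp.single_apply, Prod.mk.injEq]
    by_cases h : y = g
    · simp [h, singleHom, mul_comm]
    · simp [h, singleHom]

/-- The nontrivial character of the group of order two. -/
def signCharacter : Multiplicative (ZMod 2) →* ℤ where
  toFun z := if z = 1 then 1 else -1
  map_one' := by decide
  map_mul' := by decide

/-- The two characters of `C₂` send `u = u₀ + u₁z` to the units `u₀ + u₁` and `u₀ - u₁` of `ℤA`. The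
parallelogram law then recovers the sum of squares for `u`. -/
theorem HasTrivialUnits.prod_two {A : Type*} [Group A] [Fintype A] (hA : HasTrivialUnits A) :
    HasTrivialUnits (A × Multiplicative (ZMod 2)) := by
  intro u w huw
  have hsum : ∀ f : Multiplicative (ZMod 2) → ℤ, ∑ z, f z =
      f 1 + f (Multiplicative.ofAdd 1) := fun f => Fin.sum_univ_two f
  have h : ∀ ε : Multiplicative (ZMod 2) →* ℤ,
      ∑ g, (∑ z, ε z * u.coeff (g, z)) ^ 2 = 1 := by
    intro ε
    have := hA (characterMap A ε u) (characterMap A ε w) (by rw [← map_mul, huw, map_one])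
    simpa only [coeff_characterMap] using this
  have h1 := h 1
  have h2 := h signCharacter
  have h3 : signCharacter (Multiplicative.ofAdd 1) = -1 := by decide
  simp only [hsum, map_one, h3, MonoidHom.one_apply, one_mul] at h1 h2
  rw [Fintype.sum_prod_type]
  simp only [hsum]
  have h4 : 2 * ∑ g, (u.coeff (g, 1) ^ 2 + u.coeff (g, Multiplicative.ofAdd 1) ^ 2) = 1 + 1 := by
    nth_rw 1 [← h1]
    rw [← h2, ← Finset.sum_add_distrib, Finset.mul_sum]
    exact Finset.sum_congr rfl fun g _ => by ring
  omega

theorem HasTrivialUnits.prod_pi {A : Type*} [Group A] [Fintype A] (hA : HasTrivialUnits A)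
    (n : ℕ) : HasTrivialUnits (A × Multiplicative (Fin n → ZMod 2)) := by
  induction n with
  | zero => exact hA.of_mulEquiv MulEquiv.prodUnique
  | succ n ih =>
    refine ih.prod_two.of_mulEquiv
      { toFun := fun x => ((x.1, .ofAdd (Fin.tail x.2.toAdd)), .ofAdd (x.2.toAdd 0))
        invFun := fun y => (y.1.1, .ofAdd (Fin.cons y.2.toAdd y.1.2.toAdd))
        left_inv := fun x => by simp
        right_inv := fun y => by simp
        map_mul' := fun x y => rfl }

theorem exists_mulEquiv_pi_zmod_two {E : Type*} [Group E] [Finite E] (hE : ∀ e : E, e ^ 2 = 1) :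
    ∃ n : ℕ, Nonempty (E ≃* Multiplicative (Fin n → ZMod 2)) := by
  have hinv : ∀ e : E, e⁻¹ = e := fun e => inv_eq_of_mul_eq_one_left (by rw [← pow_two, hE])
  let _ : CommGroup E :=
    { (inferInstance : Group E) with
      mul_comm := fun e f => by rw [← hinv (e * f), mul_inv_rev, hinv, hinv] }
  let _ : Module (ZMod 2) (Additive E) := AddCommGroup.zmodModule fun x => hE x.toMul
  let b := Module.finBasis (ZMod 2) (Additive E)
  exact ⟨_, ⟨AddEquiv.toMultiplicativeRight b.equivFun.toAddEquiv⟩⟩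

instance : DecidableEq (Quaternion ℤ) := fun x y =>
  decidable_of_iff (x.re = y.re ∧ x.imI = y.imI ∧ x.imJ = y.imJ ∧ x.imK = y.imK)
    (by rw [Quaternion.ext_iff])

/-- The Lipschitz quaternion `a + b i + c j + d k`. -/
def lipschitz (a b c d : ℤ) : Quaternion ℤ := ⟨a, b, c, d⟩

theorem normSq_lipschitz (a b c d : ℤ) :
    Quaternion.normSq (lipschitz a b c d) = a ^ 2 + b ^ 2 + c ^ 2 + d ^ 2 :=
  Quaternion.normSq_def' _

theorem lipschitz_add (a b c d a' b' c' d' : ℤ) : lipschitz a b c d + lipschitz a' b' c' d' =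
    lipschitz (a + a') (b + b') (c + c') (d + d') := rfl

theorem zsmul_lipschitz (n a b c d : ℤ) :
    n • lipschitz a b c d = lipschitz (n * a) (n * b) (n * c) (n * d) := by
  have h1 : (n : Quaternion ℤ) = lipschitz n 0 0 0 := rfl
  rw [zsmul_eq_mul, h1]
  ext
  · rw [Quaternion.re_mul]; simp [lipschitz]
  · rw [Quaternion.imI_mul]; simp [lipschitz]
  · rw [Quaternion.imJ_mul]; simp [lipschitz]
  · rw [Quaternion.imK_mul]; simp [lipschitz]

/-- The imaginary unit `i` of the Lipschitz quaternions. -/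
def unitI : (Quaternion ℤ)ˣ := ⟨⟨0, 1, 0, 0⟩, ⟨0, -1, 0, 0⟩, by decide, by decide⟩

/-- The imaginary unit `j` of the Lipschitz quaternions. -/
def unitJ : (Quaternion ℤ)ˣ := ⟨⟨0, 0, 1, 0⟩, ⟨0, 0, -1, 0⟩, by decide, by decide⟩

theorem isQuaternionPair_unitI_unitJ : IsQuaternionPair unitI unitJ := by
  constructor <;> decide

/-- The quaternion group inside the Lipschitz quaternions. -/
def quaternionEmbedding : QuaternionGroup 2 →* Quaternion ℤ :=
  (Units.coeHom _).comp isQuaternionPair_unitI_unitJ.hom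

/-- The character of the quaternion group with prescribed values on the generators. -/
def quaternionCharacter (s t : ℤˣ) : QuaternionGroup 2 →* ℤ where
  toFun q := match q with
    | .a i => s ^ i.val
    | .xa i => t * s ^ i.val
  map_one' := by decide +revert
  map_mul' := by decide +revert

theorem sum_quaternionGroup_two {M : Type*} [AddCommMonoid M] (f : QuaternionGroup 2 → M) :
    ∑ q, f q = (f (.a 0) + f (.a 1) + f (.a 2) + f (.a 3)) +
      (f (.xa 0) + f (.xa 1) + f (.xa 2) + f (.xa 3)) := by
  have : (Finset.univ : Finset (QuaternionGroup 2)) =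
      {.a 0, .a 1, .a 2, .a 3, .xa 0, .xa 1, .xa 2, .xa 3} := by decide
  rw [this]
  repeat rw [Finset.sum_insert (by decide)]
  rw [Finset.sum_singleton]
  abel

theorem lift_eq_sum {A G : Type*} [Ring A] [Group G] [Fintype G] (ρ : G →* A)
    (u : MonoidAlgebra ℤ G) : MonoidAlgebra.lift ℤ A G ρ u = ∑ g, u.coeff g • ρ g := by
  rw [lift_apply, Finsupp.sum_fintype _ _ (fun _ => zero_zsmul _)]

/-- The four linear characters send a unit to `±1`, and the Lipschitz quaternions send it to an
element of norm 1. -/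
theorem hasTrivialUnits_quaternionGroup : HasTrivialUnits (QuaternionGroup 2) := by
  intro u w huw
  have hχ : ∀ s t : ℤˣ, (∑ q, u.coeff q • quaternionCharacter s t q) ^ 2 = 1 := by
    intro s t
    rw [← lift_eq_sum]
    exact Int.isUnit_sq (IsUnit.of_mul_eq_one (lift ℤ _ _ (quaternionCharacter s t) w)
      (by rw [← map_mul, huw, map_one]))
  have hN : Quaternion.normSq (∑ q, u.coeff q • quaternionEmbedding q) = 1 := by
    rw [← lift_eq_sum]
    have h1 : IsUnit (Quaternion.normSq (lift ℤ _ _ quaternionEmbedding u)) :=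
      IsUnit.of_mul_eq_one (Quaternion.normSq (lift ℤ _ _ quaternionEmbedding w))
        (by rw [← map_mul, ← map_mul, huw, map_one, map_one])
    rcases Int.isUnit_iff.1 h1 with h2 | h2
    · exact h2
    · have : 0 ≤ Quaternion.normSq (lift ℤ _ _ quaternionEmbedding u) := Quaternion.normSq_nonneg
      omega
  have e0 : quaternionEmbedding (.a 0) = lipschitz 1 0 0 0 := by decide
  have e1 : quaternionEmbedding (.a 1) = lipschitz 0 1 0 0 := by decide
  have e2 : quaternionEmbedding (.a 2) = lipschitz (-1) 0 0 0 := by decide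
  have e3 : quaternionEmbedding (.a 3) = lipschitz 0 (-1) 0 0 := by decide
  have e4 : quaternionEmbedding (.xa 0) = lipschitz 0 0 1 0 := by decide
  have e5 : quaternionEmbedding (.xa 1) = lipschitz 0 0 0 (-1) := by decide
  have e6 : quaternionEmbedding (.xa 2) = lipschitz 0 0 (-1) 0 := by decide
  have e7 : quaternionEmbedding (.xa 3) = lipschitz 0 0 0 1 := by decide
  rw [sum_quaternionGroup_two, e0, e1, e2, e3, e4, e5, e6, e7] at hN
  simp only [zsmul_lipschitz, lipschitz_add, normSq_lipschitz] at hN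
  have f : ∀ s t : ℤˣ, quaternionCharacter s t (.a 0) = 1 ∧ quaternionCharacter s t (.a 1) = s ∧
      quaternionCharacter s t (.a 2) = 1 ∧ quaternionCharacter s t (.a 3) = s ∧
      quaternionCharacter s t (.xa 0) = t ∧ quaternionCharacter s t (.xa 1) = t * s ∧
      quaternionCharacter s t (.xa 2) = t ∧ quaternionCharacter s t (.xa 3) = t * s := by decide
  simp only [sum_quaternionGroup_two, f, smul_eq_mul] at hχ ⊢
  have h1 := hχ 1 1
  have h2 := hχ 1 (-1)
  have h3 := hχ (-1) 1
  have h4 := hχ (-1) (-1)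
  push_cast at h1 h2 h3 h4
  have h8 : (8 : ℤ) ≠ 0 := by norm_num
  refine mul_left_cancel₀ h8 ?_
  -- Parseval for `Q₈`: eight times the sum of squares is the sum of the four squared character
  -- values plus four times the quaternion norm, that is `4 + 4`.
  linear_combination h1 + h2 + h3 + h4 + 4 * hN

/-- For a normalized unit the coefficients and their squares both sum to 1. Since `n ≤ n ^ 2` for
integers, equality holds termwise, so each coefficient is 0 or 1. -/
theorem HasTrivialUnits.surjective {G : Type*} [Group G] [Fintype G] (hG : HasTrivialUnits G) :
    Function.Surjective (groupToNormalizedUnits G) := by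
  classical
  rintro ⟨u, hu⟩
  obtain ⟨x, hx⟩ : ∃ x, x = (u : MonoidAlgebra ℤ G) := ⟨_, rfl⟩
  have h1 : ∑ g, x.coeff g ^ 2 = 1 := by rw [hx]; exact hG _ _ u.mul_inv
  have h2 : ∑ g, x.coeff g = 1 := by
    have h3 : augmentation G x = 1 := by rw [hx]; exact hu
    rw [augmentation, lift_eq_sum] at h3
    simpa using h3
  have h3 : ∀ g, x.coeff g ^ 2 - x.coeff g = 0 := by
    have h4 : ∑ g, (x.coeff g ^ 2 - x.coeff g) = 0 := by
      rw [Finset.sum_sub_distrib, h1, h2, sub_self]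
    have h5 := (Finset.sum_eq_zero_iff_of_nonneg (fun g _ => by
      rw [sub_nonneg]; exact Int.le_self_sq _)).1 h4
    exact fun g => h5 g (Finset.mem_univ g)
  have h01 : ∀ g, x.coeff g = 0 ∨ x.coeff g = 1 := fun g => by
    have h4 : x.coeff g * (x.coeff g - 1) = 0 := by rw [← h3 g]; ring
    exact (mul_eq_zero.1 h4).imp_right sub_eq_zero.1
  obtain ⟨g, -, hg⟩ := Finset.exists_ne_zero_of_sum_ne_zero (h2.symm ▸ one_ne_zero)
  have hg1 := (h01 g).resolve_left hg
  refine ⟨g, Subtype.ext (Units.ext ?_)⟩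
  change of ℤ G g = (u : MonoidAlgebra ℤ G)
  rw [← hx, of_apply]
  ext k
  rw [coeff_single, Finsupp.single_apply]
  split_ifs with hk
  · rw [← hk, hg1]
  · rw [← Finset.add_sum_erase _ _ (Finset.mem_univ g), hg1, add_eq_left] at h2
    exact ((Finset.sum_eq_zero_iff_of_nonneg (fun k _ => by
      rcases h01 k with h | h <;> simp [h])).1 h2 k
      (Finset.mem_erase.2 ⟨Ne.symm hk, Finset.mem_univ k⟩)).symm

end Units

/-! ### Derived subgroups and the main theorem -/

theorem commutator_eq_map_of_surjective {G : Type*} [Group G]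
    (h : Function.Surjective (groupToNormalizedUnits G)) :
    commutator (normalizedUnits G) = (commutator G).map (groupToNormalizedUnits G) := by
  rw [commutator_def, commutator_def, Subgroup.map_commutator, ← MonoidHom.range_eq_map,
    MonoidHom.range_eq_top.2 h]

theorem commutator_eq_map_of_comm {G : Type*} [Group G] (hG : ∀ a b : G, a * b = b * a) :
    commutator (normalizedUnits G) = (commutator G).map (groupToNormalizedUnits G) := by
  have h1 : commutator G = ⊥ := by
    rw [commutator_eq_bot_iff_center_eq_top, eq_top_iff]
    exact fun g _ => Subgroup.mem_center_iff.2 fun k => hG k g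
  have h2 : commutator (normalizedUnits G) = ⊥ := by
    rw [commutator_eq_bot_iff_center_eq_top, eq_top_iff]
    refine fun g _ => Subgroup.mem_center_iff.2 fun k => Subtype.ext (Units.ext ?_)
    let _ : CommGroup G := { (inferInstance : Group G) with mul_comm := hG }
    exact mul_comm (k.1 : MonoidAlgebra ℤ G) (g.1 : MonoidAlgebra ℤ G)
  rw [h1, h2, Subgroup.map_bot]

theorem IsHamiltonianTwoGroup.exists_mulEquiv {G : Type*} [Group G] [Finite G]
    (hG : IsHamiltonianTwoGroup G) : ∃ E : Subgroup G, (∀ e : E, e ^ 2 = 1) ∧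
      Nonempty (G ≃* QuaternionGroup 2 × E) := by
  obtain ⟨a, b, h⟩ := hG.exists_isQuaternionPair
  exact h.exists_mulEquiv hG.2 hG.1.2

theorem IsHamiltonianTwoGroup.hasTrivialUnits {G : Type*} [Group G] [Fintype G]
    (hG : IsHamiltonianTwoGroup G) : HasTrivialUnits G := by
  obtain ⟨E, hE, ⟨φ⟩⟩ := hG.exists_mulEquiv
  obtain ⟨n, ⟨ψ⟩⟩ := exists_mulEquiv_pi_zmod_two hE
  exact (hasTrivialUnits_quaternionGroup.prod_pi n).of_mulEquiv
    (φ.trans (MulEquiv.prodCongr (MulEquiv.refl _) ψ))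

theorem mainTheorem1 {G : Type u} [Group G] [Finite G] :
    (commutator (normalizedUnits G) = (commutator G).map (groupToNormalizedUnits G) ↔
      (∀ a b : G, a * b = b * a) ∨ IsHamiltonianTwoGroup G) ∧
    (IsHamiltonianTwoGroup G ↔
      ∃ (E : Type u) (_ : Group E), (∀ e : E, e ^ 2 = 1) ∧
        Nonempty (G ≃* QuaternionGroup 2 × E)) := by
  refine ⟨⟨fun h => ?_, ?_⟩, fun h => ?_, ?_⟩
  · by_contra! hne
    obtain ⟨hab, hnot⟩ := hne
    exact hnot ((unitsNormalize_of_commutator_eq h).isHamiltonianTwoGroup hab)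
  · rintro (h | h)
    · exact commutator_eq_map_of_comm h
    · have := Fintype.ofFinite G
      exact commutator_eq_map_of_surjective h.hasTrivialUnits.surjective
  · obtain ⟨E, hE, φ⟩ := h.exists_mulEquiv
    exact ⟨E, inferInstance, hE, φ⟩
  · rintro ⟨E, _, hE, ⟨φ⟩⟩
    exact isHamiltonianTwoGroup_of_mulEquiv hE φ
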